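/- \textbf{Setting.} An instance consists of a finite bipartite graph $G=(V\cup U,E)$ with $E\subseteq V\times U$, and a reward $f_e\in\mathbb{R}$ and a cost $c_e\in\mathbb{R}$ for every edge $e\in E$. For $S\subseteq E$ let $f(S)$ be the maximum of $\sum_{e\in M}f_e$ over all matchings $M\subseteq S$ (matching-based reward), and let $c(S)=\sum_{e\in S}c_e$ (additive cost). For a contract $\alpha\in[0,1]$ the agent's utility from $S\subseteq E$ is $u_a(\alpha,S)=\alpha f(S)-c(S)$; the agent's best responses to $\alpha$ are the sets $S\subseteq E$ that maximize $u_a(\alpha,\cdot)$ and, among these maximizers, have the highest reward $f(S)$ (ties are broken in favor of the principal). A contract $\alpha\in(0,1]$ is a \emph{critical value} if the agent's best response changes at $\alpha$, i.e. there is no $\beta\in[0,\alpha)$ such that the set of best responses is constant on $[\beta,\alpha]$; in addition, $0$ is counted as a critical value. For real $\alpha$ put $w_\alpha(e)=\alpha f_e-c_e$; a maximum weight matching with respect to $w_\alpha$ is a matching of $G$ (not necessarily perfect) whose total weight $\sum_{e\in M}w_\alpha(e)$ is the largest among all matchings of $G$. \textbf{Theorem.} There is a family of instances $G_n=(V_n\cup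 U_n,E_n)$, $n\in\mathbb{N}$, with rewards and costs as above, such that $G_n$ has $O(n^4)$ vertices, together with integers $m=m_n\ge 2$ with $m_n\ge 2^{\Omega(\log^2 n)}$ (that is, there is a constant $\kappa>0$ with $m_n\ge 2^{\kappa\log^2 n}$ for all sufficiently large $n$), critical values $0<\alpha_2<\dots<\alpha_m$ of the instance $G_n$ (where the $\alpha_i$ depend on $n$), and a real number $Q_n>\alpha_m$, such that for every $n$: \begin{enumerate} \item $f_e\ge 0$ and $c_e\ge 0$ for every $e\in E_n$. \item $f(S)\in[0,1]$ for every $S\subseteq E_n$. \item $w_\alpha(e)\ge 0$ for every $\alpha\in[\alpha_2,Q_n]$ and every $e\in E_n$. \item For every $i\in\{2,\dots,m\}$, every maximum weight matching of $G_n$ with respect to $w_{\alpha_i}$ is a perfect matching. Moreover, there are pairwise distinct matchings $M_2,\dots,M_m$ of $G_n$ such that, for every $i$, $M_i$ is a maximum weight matching with respect to $w_{\alpha_i}$ and is a best response of the agent to the contract $\alpha_i$. \end{enumerate} In particular, the number of critical values may be super-polynomial in the size of the graph. -/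

import Mathlib

open Filter Asymptotics

noncomputable section

/-- A finite bipartite graph with sides `V` (tasks) and `U` (resources) and edge set
`edges ⊆ V × U`, together with a reward and a cost for every edge. The edges are the actions of
the agent. (Values of `reward` and `cost` outside `edges` are never used; non-negativity and
normalization are not built in.) -/
structure MatchingInstance where
  V : Type
  U : Type
  [fintypeV : Fintype V]
  [fintypeU : Fintype U]
  edges : Finset (V × U)
  reward : V × U → ℝ
  cost : V × U → ℝ

attribute [instance] MatchingInstance.fintypeV MatchingInstance.fintypeU

/-- A set of edges is a matching if distinct edges in it share no endpoint on either side. -/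
def IsBipartiteMatching {V U : Type} (M : Finset (V × U)) : Prop :=
  ∀ e ∈ M, ∀ e' ∈ M, e ≠ e' → e.1 ≠ e'.1 ∧ e.2 ≠ e'.2

theorem isBipartiteMatching_empty {V U : Type} :
    IsBipartiteMatching (∅ : Finset (V × U)) := by
  intro e he
  simp at he

open Classical in
/-- The set of all matchings contained in the edge set `S`. -/
def matchingsIn {V U : Type} (S : Finset (V × U)) : Finset (Finset (V × U)) :=
  S.powerset.filter IsBipartiteMatching

theorem matchingsIn_nonempty {V U : Type} (S : Finset (V × U)) : (matchingsIn S).Nonempty :=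
  ⟨∅, by simp [matchingsIn, isBipartiteMatching_empty]⟩

namespace MatchingInstance

/-- The matching-based reward `f(S)`: the maximum total reward of a matching contained in `S`. -/
def setReward (G : MatchingInstance) (S : Finset (G.V × G.U)) : ℝ :=
  (matchingsIn S).sup' (matchingsIn_nonempty S) fun M => ∑ e ∈ M, G.reward e

/-- The additive cost `c(S)`. -/
def setCost (G : MatchingInstance) (S : Finset (G.V × G.U)) : ℝ :=
  ∑ e ∈ S, G.cost e

/-- The agent's utility `u_a(a, S) = a f(S) - c(S)` under the contract `a`. -/
def agentUtility (G : MatchingInstance) (a : ℝ) (S : Finset (G.V × G.U)) : ℝ :=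
  a * G.setReward S - G.setCost S

/-- The agent's demand under the contract `a`: all sets of actions of maximum utility. -/
def demand (G : MatchingInstance) (a : ℝ) : Set (Finset (G.V × G.U)) :=
  {S | S ⊆ G.edges ∧ ∀ T ⊆ G.edges, G.agentUtility a T ≤ G.agentUtility a S}

/-- The agent's best responses to the contract `a`: the sets in the demand that are best for the
principal, i.e. ties are broken in favor of higher reward. -/
def bestResponse (G : MatchingInstance) (a : ℝ) : Set (Finset (G.V × G.U)) :=
  {S | S ∈ G.demand a ∧ ∀ T ∈ G.demand a, G.setReward T ≤ G.setReward S}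

/-- A contract `a ∈ [0, 1]` is a critical value if the agent's best response changes at `a`: it is
not constant on any interval `[b, a]` with `0 ≤ b < a`. (Because of the tie breaking, the best
response is always constant on some interval to the right of `a`, so only the left side matters.
The contract `0` counts as critical by convention.) -/
def IsCriticalValue (G : MatchingInstance) (a : ℝ) : Prop :=
  a ∈ Set.Icc (0 : ℝ) 1 ∧
    ∀ b ∈ Set.Ico 0 a, ∃ x ∈ Set.Ico b a, G.bestResponse x ≠ G.bestResponse a

/-- The affine edge weight `w_a(e) = a f_e - c_e`. -/
def weight (G : MatchingInstance) (a : ℝ) (e : G.V × G.U) : ℝ :=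
  a * G.reward e - G.cost e

/-- `M` is a matching of the graph of maximum total weight for the weights `w_a`, among all
matchings of the graph (perfect or not). -/
def IsMaxWeightMatching (G : MatchingInstance) (a : ℝ) (M : Finset (G.V × G.U)) : Prop :=
  M ⊆ G.edges ∧ IsBipartiteMatching M ∧
    ∀ M' ⊆ G.edges, IsBipartiteMatching M' → ∑ e ∈ M', G.weight a e ≤ ∑ e ∈ M, G.weight a e

/-- `M` is a perfect matching of the graph: a matching that covers every vertex of both sides. -/
def IsPerfectMatching (G : MatchingInstance) (M : Finset (G.V × G.U)) : Prop :=
  M ⊆ G.edges ∧ IsBipartiteMatching M ∧ (∀ v, ∃ e ∈ M, e.1 = v) ∧ (∀ u, ∃ e ∈ M, e.2 = u)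

end MatchingInstance

end

/-! The source of the many optima is parametric shortest paths. Suppose that near each of `N`
parameter values the cheapest path from `x` to `z` has a cost that is bilinear in `x`, `z` up to
potentials. `PathFamily.step` runs one copy of such a family forward and a second copy, scaled by `1
- τ`, backward, and joins them by an edge of quadratic cost whose minimizer drifts with the
parameter. Near each old parameter value the integer minimizer passes through `D` positions, so `N`
becomes `N * D` while the number of layers only doubles. After `k` doublings of a single edge, `D ^
k` paths are optimal in turn in `2 ^ (k + 1)` layers.

Paths become perfect matchings once each vertex is split into a source and a target copy: a back
edge closes the path to a cycle, and loops cover the vertices off it. A potential argument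
(`exists_path_le_sum_layeredCost`) shows that no perfect matching is cheaper than a shortest path.

`exists_perturbed_instance` turns the parametric cost into rewards and costs: every edge gets the
same dominant weight, which forces optimal matchings to be perfect, minus a tiny multiple of the
parametric cost. As utilities are affine in the contract, each change of the optimum between
consecutive sample contracts produces a critical value (`exists_critical_values`). Taking `D = 2 ^
k` with `k` about `log n` gives `2 ^ (k * k)` optima in a graph of polynomial size. -/

/-! ### Parametric shortest paths by recursive doubling. -/

/-- Layered paths `X 0, …, X L` of integers bounded by `R`, with edge costs depending on a
parameter, and `N` parameter values around each of which the cheapest path between any two given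
endpoints is known, together with its cost. The cost depends on the endpoints through a potential
(`left`, `right`), a bilinear term and linear terms proportional to the parameter value. -/
structure PathFamily (D R : ℕ) (τ : ℝ) (L N : ℕ) (margin : ℤ) (A ε : ℝ) where
  cost : ℕ → ℤ → ℤ → ℝ → ℝ
  left : ℤ → ℝ → ℝ
  right : ℤ → ℝ → ℝ
  base : ℕ → ℝ → ℝ
  point : ℕ → ℝ
  path : ℕ → ℤ → ℤ → ℕ → ℤ
  cost_affine : ∀ t x y, ∃ a b : ℝ, ∀ l, cost t x y l = a + l * b
  left_affine : ∀ x, ∃ a b : ℝ, ∀ l, left x l = a + l * b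
  right_affine : ∀ x, ∃ a b : ℝ, ∀ l, right x l = a + l * b
  path_start : ∀ r x z, path r x z 0 = x
  path_end : ∀ r x z, path r x z L = z
  path_bound : ∀ r < N, ∀ x z, |x| + margin ≤ R → |z| + margin ≤ R → ∀ t ≤ L, |path r x z t| ≤ R
  path_inj : ∀ r < N, ∀ r' < N, ∀ x z, (∀ t ≤ L, path r x z t = path r' x z t) → r = r'
  point_gap : ∀ r r', r < r' → r' < N → point r + 8 * D * ε ≤ point r'
  cost_path : ∀ r x z l, ∑ t ∈ Finset.range L, cost t (path r x z t) (path r x z (t + 1)) l =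
    base r l + A * point r * (x + (1 - τ) * z) + ε * A * x * z + left x l + right z l
  le_cost : ∀ r < N, ∀ l, |l - point r| ≤ D * ε → ∀ X : ℕ → ℤ, (∀ t ≤ L, |X t| ≤ R) →
    base r l + A * point r * (X 0 + (1 - τ) * X L) + ε * A * X 0 * X L + left (X 0) l
      + right (X L) l ≤ ∑ t ∈ Finset.range L, cost t (X t) (X (t + 1)) l
  eq_path : ∀ r < N, ∀ l, |l - point r| ≤ D * ε → ∀ X : ℕ → ℤ, (∀ t ≤ L, |X t| ≤ R) →
    ∑ t ∈ Finset.range L, cost t (X t) (X (t + 1)) l ≤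
      base r l + A * point r * (X 0 + (1 - τ) * X L) + ε * A * X 0 * X L + left (X 0) l
        + right (X L) l →
    ∀ t ≤ L, X t = path r (X 0) (X L) t

theorem exists_pathFamily_zero (D R : ℕ) (τ : ℝ) :
    Nonempty (PathFamily D R τ 1 1 0 1 1) := by
  refine ⟨{ cost := fun _ x y _ => x * y
            left := fun _ _ => 0
            right := fun _ _ => 0
            base := fun _ _ => 0
            point := fun _ => 0
            path := fun _ x z t => if t = 0 then x else z
            cost_affine := fun t x y => ⟨x * y, 0, by simp⟩
            left_affine := fun x => ⟨0, 0, by simp⟩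
            right_affine := fun x => ⟨0, 0, by simp⟩
            path_start := by simp
            path_end := by simp
            path_bound := ?_
            path_inj := ?_
            point_gap := ?_
            cost_path := ?_
            le_cost := ?_
            eq_path := ?_ }⟩
  · intro r _ x z hx hz t _
    split_ifs <;> omega
  · intro r hr r' hr' _ _ _
    omega
  · intro r r' h h'
    omega
  · simp
  · intro r hr l _ X _
    have : r = 0 := by omega
    subst this
    simp
  · intro r hr l _ X _ _ t ht
    interval_cases t <;> simp

theorem sum_range_reverse_half (L : ℕ) (f g : ℕ → ℝ) (h : ℝ)
    (F : ℕ → ℝ) (h1 : ∀ t < L, F t = f t) (h2 : F L = h) (h3 : ∀ t < L, F (2 * L - t) = g t) :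
    ∑ t ∈ Finset.range (2 * L + 1), F t =
      ∑ t ∈ Finset.range L, f t + h + ∑ t ∈ Finset.range L, g t := by
  have e : 2 * L + 1 = L + 1 + L := by ring
  rw [e, Finset.sum_range_add, Finset.sum_range_succ, h2]
  congr 1
  · congr 1
    exact Finset.sum_congr rfl fun t ht => h1 t (Finset.mem_range.1 ht)
  · rw [← Finset.sum_range_reflect]
    refine Finset.sum_congr rfl fun t ht => ?_
    have := Finset.mem_range.1 ht
    rw [← h3 t this]
    congr 1
    omega

/-- Integrality is what absorbs the linear terms: `|q| ≤ q ^ 2` for an integer `q`, so they cost at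
most `θ * (p ^ 2 + s ^ 2)`. The cross term is bounded by completing `b / 2 * (p + s) ^ 2`. Thus the
integer minimizer stays at the origin under small perturbations, which gives the parameter windows
positive width. -/
theorem quadratic_nonneg_of_int {a b e u v θ : ℝ} (hb : 0 ≤ b) (ha : θ < a / 2 - b / 2)
    (he : θ < e / 2 - b / 2) (hu : |u| ≤ θ) (hv : |v| ≤ θ) (p s : ℤ) :
    0 ≤ a / 2 * p ^ 2 + b * p * s + e / 2 * s ^ 2 + u * p + v * s ∧
      (a / 2 * (p : ℝ) ^ 2 + b * p * s + e / 2 * s ^ 2 + u * p + v * s ≤ 0 → p = 0 ∧ s = 0) := by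
  have key : ∀ (q : ℤ) (w : ℝ), |w| ≤ θ → -(θ * (q : ℝ) ^ 2) ≤ w * q := by
    intro q w hw
    have h1 : |(q : ℝ)| ≤ (q : ℝ) ^ 2 := by
      rw [← sq_abs]
      rcases eq_or_ne q 0 with rfl | hq
      · simp
      · have : (1 : ℝ) ≤ |(q : ℝ)| := by exact_mod_cast Int.one_le_abs hq
        nlinarith
    have h2 : |w * q| ≤ θ * (q : ℝ) ^ 2 := by
      rw [abs_mul]
      exact mul_le_mul hw h1 (abs_nonneg _) ((abs_nonneg _).trans hw)
    exact (abs_le.1 h2).1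
  have h1 := key p u hu
  have h2 := key s v hv
  have h3 : 0 ≤ b * ((p : ℝ) + s) ^ 2 := by positivity
  have hp : 0 ≤ (a / 2 - b / 2 - θ) * (p : ℝ) ^ 2 := by
    have : 0 ≤ a / 2 - b / 2 - θ := by linarith
    positivity
  have hs : 0 ≤ (e / 2 - b / 2 - θ) * (s : ℝ) ^ 2 := by
    have : 0 ≤ e / 2 - b / 2 - θ := by linarith
    positivity
  refine ⟨by nlinarith, fun h => ?_⟩
  have hp' : (a / 2 - b / 2 - θ) * (p : ℝ) ^ 2 = 0 := by nlinarith
  have hs' : (e / 2 - b / 2 - θ) * (s : ℝ) ^ 2 = 0 := by nlinarith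
  have hp0 : (a / 2 - b / 2 - θ) ≠ 0 := by linarith
  have hs0 : (e / 2 - b / 2 - θ) ≠ 0 := by linarith
  simp_all

-- Index `r` splits into the old index `r / D` and a digit `d = r % D`. A path from `x` to `z`
-- crosses the joining edge from `y` to `u`, and the optimum is `y = d - x`, `u = d - z`. The
-- scaling by `1 - τ` keeps the recursion alive: `x + (1 - τ) * (d - x)` still contains `τ * x`, so
-- the parameter-dependent linear term survives with `A` replaced by `τ * A`, and the cross term `b
-- * y * u` supplies the new bilinear term.
set_option maxHeartbeats 1600000 in
theorem PathFamily.step {D R : ℕ} {τ : ℝ} {L N : ℕ} {margin : ℤ} {A ε : ℝ}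
    (G : PathFamily D R τ L N margin A ε) (hD : 0 < D) (hτ : τ = 1 / (32 * (R + 1)))
    (hA : 0 < A) (hε : 0 < ε) :
    Nonempty (PathFamily D R τ (2 * L + 1) (N * D) (margin + D) (τ * A) (ε / (8 * D))) := by
  have hD1 : (1 : ℝ) ≤ D := by exact_mod_cast hD
  have hR : (0 : ℝ) ≤ R := R.cast_nonneg
  have hτ0 : 0 < τ := by rw [hτ]; positivity
  have hτR : τ * (R + 1) = 1 / 32 := by rw [hτ]; field_simp
  have hτ1 : τ ≤ 1 / 32 := by nlinarith
  -- `b` is the bilinear coefficient wanted for the new family. The values of `a + b` and `e + b`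
  -- are forced: after the substitution `y = d - x`, `u = d - z`, the terms in `d * x` and `d * z`
  -- must add up to the shift `ε * d` of the new parameter point.
  obtain ⟨b, hb⟩ : ∃ b, b = ε / (8 * D) * (τ * A) := ⟨_, rfl⟩
  obtain ⟨a, ha⟩ : ∃ a, a = ε * (1 - τ) * A - b := ⟨_, rfl⟩
  obtain ⟨e, he⟩ : ∃ e, e = ε * (1 - τ) ^ 2 * A - b := ⟨_, rfl⟩
  have hεA : 0 < ε * A := by positivity
  have hb0 : 0 ≤ b := by rw [hb]; positivity
  have hb1 : b ≤ ε * A * τ / 8 := by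
    have : b = ε * A * τ / 8 / D := by rw [hb]; field_simp
    rw [this]
    exact div_le_self (by positivity) hD1
  have hmodD : ∀ r : ℕ, ((r % D : ℕ) : ℝ) + 1 ≤ D := fun r => by exact_mod_cast Nat.mod_lt r hD
  have hstep : (D : ℝ) * (ε / (8 * D)) = ε / 8 := by field_simp
  -- the connecting edge
  let h : ℤ → ℤ → ℝ → ℝ := fun y u l => a / 2 * y ^ 2 + b * y * u + e / 2 * u ^ 2
    - (1 - τ) * A * l * y - (1 - τ) ^ 2 * A * l * u - G.right y l - (1 - τ) * G.right u l
  let left' : ℤ → ℝ → ℝ := fun x l => G.left x l + (a / 2 - ε * A) * x ^ 2 + (1 - τ) * A * l * x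
  let right' : ℤ → ℝ → ℝ := fun z l => (1 - τ) * G.left z l
    + (e / 2 - (1 - τ) * (ε * A)) * z ^ 2 + (1 - τ) ^ 2 * A * l * z
  let cost' : ℕ → ℤ → ℤ → ℝ → ℝ := fun t x y l => if t < L then G.cost t x y l else
    if t = L then h x y l else (1 - τ) * G.cost (2 * L - t) y x l
  let point' : ℕ → ℝ := fun r => G.point (r / D) + ε * (r % D : ℕ)
  let base' : ℕ → ℝ → ℝ := fun r l => (2 - τ) * G.base (r / D) l
    + (a / 2 + b + e / 2) * ((r % D : ℕ) : ℝ) ^ 2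
    - ((1 - τ) + (1 - τ) ^ 2) * A * (l - G.point (r / D)) * (r % D : ℕ)
  let path' : ℕ → ℤ → ℤ → ℕ → ℤ := fun r x z t =>
    if t ≤ L then G.path (r / D) x ((r % D : ℕ) - x) t
    else G.path (r / D) z ((r % D : ℕ) - z) (2 * L + 1 - t)
  have hsum : ∀ (X : ℕ → ℤ) (l : ℝ),
      ∑ t ∈ Finset.range (2 * L + 1), cost' t (X t) (X (t + 1)) l =
        ∑ t ∈ Finset.range L, G.cost t (X t) (X (t + 1)) l + h (X L) (X (L + 1)) l
          + (1 - τ) * ∑ t ∈ Finset.range L,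
            G.cost t (X (2 * L + 1 - t)) (X (2 * L + 1 - (t + 1))) l := by
    intro X l
    rw [Finset.mul_sum]
    refine sum_range_reverse_half L _ _ _ _ (fun t ht => ?_) ?_ fun t ht => ?_
    · simp [cost', ht]
    · simp [cost']
    · have h1 : ¬ 2 * L - t < L := by omega
      have h2 : 2 * L - t ≠ L := by omega
      have h3 : 2 * L - (2 * L - t) = t := by omega
      have h4 : 2 * L - t + 1 = 2 * L + 1 - t := by omega
      have h5 : 2 * L - t = 2 * L + 1 - (t + 1) := by omega
      simp only [cost', h1, h2, if_false, h3, h4]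
      rw [h5]
  -- the cost of a path whose halves are optimal, by completing the square
  have hident : ∀ (r : ℕ) (x z y u : ℤ) (l : ℝ),
      (G.base (r / D) l + A * G.point (r / D) * (x + (1 - τ) * y) + ε * A * x * y + G.left x l
        + G.right y l) + h y u l + (1 - τ) * (G.base (r / D) l
        + A * G.point (r / D) * (z + (1 - τ) * u) + ε * A * z * u + G.left z l + G.right u l) =
      (base' r l + τ * A * point' r * (x + (1 - τ) * z) + ε / (8 * D) * (τ * A) * x * z
        + left' x l + right' z l) +
      (a / 2 * ((y - ((r % D : ℕ) - x) : ℤ) : ℝ) ^ 2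
        + b * ((y - ((r % D : ℕ) - x) : ℤ) : ℝ) * ((u - ((r % D : ℕ) - z) : ℤ) : ℝ)
        + e / 2 * ((u - ((r % D : ℕ) - z) : ℤ) : ℝ) ^ 2
        + ((1 - τ) * A * (point' r - l) + x * (ε * A - a) - b * z)
          * ((y - ((r % D : ℕ) - x) : ℤ) : ℝ)
        + ((1 - τ) ^ 2 * A * (point' r - l) - b * x + z * ((1 - τ) * (ε * A) - e))
          * ((u - ((r % D : ℕ) - z) : ℤ) : ℝ)) := by
    intro r x z y u l
    rw [← hb]
    simp only [h, base', point', left', right', ha, he]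
    simp only [Int.cast_sub, Int.cast_natCast]
    ring
  -- In units of `ε * A`, the window contributes `1 / 8`, the factor `τ` times an endpoint `1 / 32`
  -- (hence the choice of `τ`), and the two `b` terms `1 / 256` each; the sum is below `7 / 32`.
  have hlin : ∀ (r : ℕ) (l : ℝ) (x z : ℤ), |l - point' r| ≤ D * (ε / (8 * D)) → |x| ≤ R → |z| ≤ R →
      |(1 - τ) * A * (point' r - l) + x * (ε * A - a) - b * z| ≤ ε * A * (7 / 32) ∧
      |(1 - τ) ^ 2 * A * (point' r - l) - b * x + z * ((1 - τ) * (ε * A) - e)|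
        ≤ ε * A * (7 / 32) := by
    intro r l x z hl hx hz
    rw [hstep, abs_sub_comm] at hl
    have hx' : |(x : ℝ)| ≤ R := by exact_mod_cast hx
    have hz' : |(z : ℝ)| ≤ R := by exact_mod_cast hz
    have hb2 : b * (R + 1) ≤ ε * A / 256 := by
      calc b * (R + 1) ≤ ε * A * τ / 8 * (R + 1) := by gcongr
        _ = ε * A * (τ * (R + 1)) / 8 := by ring
        _ = ε * A / 256 := by rw [hτR]; ring
    have hτx : ∀ y : ℤ, |(y : ℝ)| ≤ R → |ε * A * τ * y| ≤ ε * A / 32 := by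
      intro y hy
      rw [abs_mul, abs_of_nonneg (by positivity : 0 ≤ ε * A * τ)]
      calc ε * A * τ * |(y : ℝ)| ≤ ε * A * τ * (R + 1) := by gcongr; linarith
        _ = ε * A * (τ * (R + 1)) := by ring
        _ = ε * A / 32 := by rw [hτR]; ring
    have hbx : ∀ y : ℤ, |(y : ℝ)| ≤ R → |b * y| ≤ ε * A / 256 := by
      intro y hy
      rw [abs_mul, abs_of_nonneg hb0]
      refine le_trans ?_ hb2
      gcongr
      linarith
    have hw : ∀ q : ℝ, 0 ≤ q → q ≤ 1 → |q * A * (point' r - l)| ≤ ε * A / 8 := by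
      intro q hq0 hq1
      rw [abs_mul, abs_of_nonneg (by positivity : 0 ≤ q * A)]
      calc q * A * |point' r - l| ≤ 1 * A * (ε / 8) := by gcongr
        _ = ε * A / 8 := by ring
    have w1 := abs_le.1 (hw (1 - τ) (by linarith) (by linarith))
    have w2 := abs_le.1 (hw ((1 - τ) ^ 2) (by positivity) (by nlinarith))
    have t1 := abs_le.1 (hτx x hx')
    have t2 := abs_le.1 (hτx z hz')
    have t3 : |(1 - τ) * (ε * A * τ * z)| ≤ ε * A / 32 := by
      rw [abs_mul, abs_of_nonneg (by linarith : 0 ≤ 1 - τ)]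
      nlinarith [hτx z hz', abs_nonneg (ε * A * τ * z)]
    have t3 := abs_le.1 t3
    have b1 := abs_le.1 (hbx x hx')
    have b2 := abs_le.1 (hbx z hz')
    have e1 : (1 - τ) * A * (point' r - l) + x * (ε * A - a) - b * z =
        (1 - τ) * A * (point' r - l) + (ε * A * τ * x + b * x) - b * z := by rw [ha]; ring
    have e2 : (1 - τ) ^ 2 * A * (point' r - l) - b * x + z * ((1 - τ) * (ε * A) - e) =
        (1 - τ) ^ 2 * A * (point' r - l) - b * x + ((1 - τ) * (ε * A * τ * z) + b * z) := by
      rw [he]; ring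
    rw [e1, e2, abs_le, abs_le]
    refine ⟨⟨?_, ?_⟩, ?_, ?_⟩ <;> linarith
  -- The new window has radius `ε / 8` and its centre is at most `(D - 1) * ε` from the old one, so
  -- the optimality of both halves applies.
  have hwindow : ∀ (r : ℕ) (l : ℝ), |l - point' r| ≤ D * (ε / (8 * D)) →
      |l - G.point (r / D)| ≤ D * ε := by
    intro r l hl
    rw [hstep] at hl
    simp only [point'] at hl
    have h1 := hmodD r
    have h2 : (0 : ℝ) ≤ ((r % D : ℕ) : ℝ) := Nat.cast_nonneg _
    rw [abs_le] at hl ⊢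
    constructor <;> nlinarith
  have hdiv : ∀ r < N * D, r / D < N := fun r hr => (Nat.div_lt_iff_lt_mul hD).2 hr
  have hquad := fun (r : ℕ) (l : ℝ) (x z : ℤ) (hl : |l - point' r| ≤ D * (ε / (8 * D)))
      (hx : |x| ≤ (R : ℤ)) (hz : |z| ≤ (R : ℤ)) =>
    quadratic_nonneg_of_int (a := a) (b := b) (e := e) (θ := ε * A * (7 / 32)) hb0
      (by rw [ha]; nlinarith) (by rw [he]; nlinarith) (hlin r l x z hl hx hz).1
      (hlin r l x z hl hx hz).2
  have hpath_bound : ∀ r < N * D, ∀ x z, |x| + (margin + D) ≤ R → |z| + (margin + D) ≤ R →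
      ∀ t ≤ 2 * L + 1, |path' r x z t| ≤ R := by
    intro r hr x z hx hz t ht
    have h1 : ((r % D : ℕ) : ℤ) < D := by exact_mod_cast Nat.mod_lt r hD
    have h2 : (0 : ℤ) ≤ ((r % D : ℕ) : ℤ) := Int.natCast_nonneg _
    simp only [path']
    split_ifs with h
    · refine G.path_bound _ (hdiv r hr) _ _ (by omega) ?_ _ h
      have h3 := abs_le.1 (le_refl |x|)
      have h4 : |((r % D : ℕ) : ℤ) - x| ≤ |x| + D := abs_le.2 ⟨by linarith, by linarith⟩
      linarith
    · refine G.path_bound _ (hdiv r hr) _ _ (by omega) ?_ _ (by omega)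
      have h3 := abs_le.1 (le_refl |z|)
      have h4 : |((r % D : ℕ) : ℤ) - z| ≤ |z| + D := abs_le.2 ⟨by linarith, by linarith⟩
      linarith
  have hpath_first : ∀ r x z, ∀ t ≤ L,
      path' r x z t = G.path (r / D) x ((r % D : ℕ) - x) t := by
    intro r x z t ht
    simp only [path', ht, if_true]
  have hpath_second : ∀ r x z, ∀ t ≤ L,
      path' r x z (2 * L + 1 - t) = G.path (r / D) z ((r % D : ℕ) - z) t := by
    intro r x z t ht
    have h1 : ¬ 2 * L + 1 - t ≤ L := by omega
    have h2 : 2 * L + 1 - (2 * L + 1 - t) = t := by omega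
    simp only [path', h1, if_false, h2]
  have hpath_mid : ∀ r x z, path' r x z (L + 1) = (r % D : ℕ) - z := by
    intro r x z
    have h1 := hpath_second r x z L le_rfl
    rw [G.path_end] at h1
    rw [← h1]
    congr 1
    omega
  have hcost_path : ∀ r x z l,
      ∑ t ∈ Finset.range (2 * L + 1), cost' t (path' r x z t) (path' r x z (t + 1)) l =
        base' r l + τ * A * point' r * (x + (1 - τ) * z) + ε / (8 * D) * (τ * A) * x * z
          + left' x l + right' z l := by
    intro r x z l
    have e1 : ∑ t ∈ Finset.range L, G.cost t (path' r x z t) (path' r x z (t + 1)) l =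
        ∑ t ∈ Finset.range L, G.cost t (G.path (r / D) x ((r % D : ℕ) - x) t)
          (G.path (r / D) x ((r % D : ℕ) - x) (t + 1)) l := by
      refine Finset.sum_congr rfl fun t ht => ?_
      have := Finset.mem_range.1 ht
      rw [hpath_first r x z t (by omega), hpath_first r x z (t + 1) (by omega)]
    have e2 : ∑ t ∈ Finset.range L, G.cost t (path' r x z (2 * L + 1 - t))
          (path' r x z (2 * L + 1 - (t + 1))) l =
        ∑ t ∈ Finset.range L, G.cost t (G.path (r / D) z ((r % D : ℕ) - z) t)
          (G.path (r / D) z ((r % D : ℕ) - z) (t + 1)) l := by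
      refine Finset.sum_congr rfl fun t ht => ?_
      have := Finset.mem_range.1 ht
      rw [hpath_second r x z t (by omega), hpath_second r x z (t + 1) (by omega)]
    rw [hsum, e1, e2, G.cost_path, G.cost_path, hpath_first r x z L le_rfl, G.path_end, hpath_mid,
      hident]
    simp only [sub_self, Int.cast_zero]
    ring
  have hlower : ∀ r < N * D, ∀ l, |l - point' r| ≤ D * (ε / (8 * D)) → ∀ X : ℕ → ℤ,
      (∀ t ≤ 2 * L + 1, |X t| ≤ R) →
      base' r l + τ * A * point' r * (X 0 + (1 - τ) * X (2 * L + 1))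
          + ε / (8 * D) * (τ * A) * X 0 * X (2 * L + 1) + left' (X 0) l + right' (X (2 * L + 1)) l
        ≤ ∑ t ∈ Finset.range (2 * L + 1), cost' t (X t) (X (t + 1)) l ∧
      (∑ t ∈ Finset.range (2 * L + 1), cost' t (X t) (X (t + 1)) l ≤
        base' r l + τ * A * point' r * (X 0 + (1 - τ) * X (2 * L + 1))
          + ε / (8 * D) * (τ * A) * X 0 * X (2 * L + 1) + left' (X 0) l
          + right' (X (2 * L + 1)) l →
        ∀ t ≤ 2 * L + 1, X t = path' r (X 0) (X (2 * L + 1)) t) := by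
    intro r hr l hl X hX
    -- `Y` is the second half read backward from the end, which makes it a path of the old family.
    obtain ⟨Y, hY⟩ : ∃ Y : ℕ → ℤ, Y = fun t => X (2 * L + 1 - t) := ⟨_, rfl⟩
    have hXb : ∀ t ≤ L, |X t| ≤ R := fun t ht => hX t (by omega)
    have hYb : ∀ t ≤ L, |Y t| ≤ R := fun t ht => by rw [hY]; exact hX _ (by omega)
    have hY0 : X (2 * L + 1) = Y 0 := by rw [hY]; rfl
    have hYL : X (L + 1) = Y L := by rw [hY]; exact congrArg X (by omega)
    have hq := hquad r l (X 0) (Y 0) hl (hX 0 (by omega)) (hYb 0 (by omega))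
      (X L - ((r % D : ℕ) - X 0)) (Y L - ((r % D : ℕ) - Y 0))
    have hid := hident r (X 0) (Y 0) (X L) (Y L) l
    have hw := hwindow r l hl
    have hq' := hdiv r hr
    have h1 := G.le_cost _ hq' l hw X hXb
    have h2 := G.le_cost _ hq' l hw Y hYb
    have h2' := mul_le_mul_of_nonneg_left h2 (by linarith : 0 ≤ 1 - τ)
    have hs := hsum X l
    rw [hYL] at hs
    have hsY : ∑ t ∈ Finset.range L, G.cost t (X (2 * L + 1 - t)) (X (2 * L + 1 - (t + 1))) l =
        ∑ t ∈ Finset.range L, G.cost t (Y t) (Y (t + 1)) l := by rw [hY]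
    rw [hsY] at hs
    rw [hs, hY0]
    refine ⟨by linarith [hq.1], fun hle => ?_⟩
    obtain ⟨hp, hs'⟩ := hq.2 (by linarith)
    have i1 := G.eq_path _ hq' l hw X hXb (by linarith [hq.1])
    have i2 := G.eq_path _ hq' l hw Y hYb (by
      refine le_of_mul_le_mul_left ?_ (by linarith : 0 < 1 - τ)
      linarith [hq.1])
    have j1 : X L = (r % D : ℕ) - X 0 := sub_eq_zero.1 hp
    have j2 : Y L = (r % D : ℕ) - Y 0 := sub_eq_zero.1 hs'
    intro t ht
    rcases le_or_gt t L with h | h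
    · rw [hpath_first _ _ _ t h, i1 t h, j1]
    · obtain ⟨s, hs, rfl⟩ : ∃ s ≤ L, t = 2 * L + 1 - s := ⟨2 * L + 1 - t, by omega, by omega⟩
      rw [hpath_second _ _ _ s hs, ← j2, ← i2 s hs, hY]
  refine ⟨{ cost := cost', left := left', right := right', base := base', point := point',
            path := path', cost_path := hcost_path, path_bound := hpath_bound,
            le_cost := fun r hr l hl X hX => (hlower r hr l hl X hX).1,
            eq_path := fun r hr l hl X hX => (hlower r hr l hl X hX).2,
            cost_affine := ?_, left_affine := ?_, right_affine := ?_, path_start := ?_,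
            path_end := ?_, path_inj := ?_, point_gap := ?_ }⟩
  · intro t x y
    obtain ⟨p1, p2, hp⟩ := G.cost_affine t x y
    obtain ⟨q1, q2, hq⟩ := G.cost_affine (2 * L - t) y x
    obtain ⟨u1, u2, hu⟩ := G.right_affine x
    obtain ⟨v1, v2, hv⟩ := G.right_affine y
    simp only [cost']
    split_ifs
    · exact ⟨p1, p2, hp⟩
    · refine ⟨a / 2 * x ^ 2 + b * x * y + e / 2 * y ^ 2 - u1 - (1 - τ) * v1,
        - (1 - τ) * A * x - (1 - τ) ^ 2 * A * y - u2 - (1 - τ) * v2, fun l => ?_⟩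
      simp only [h, hu, hv]
      ring
    · refine ⟨(1 - τ) * q1, (1 - τ) * q2, fun l => ?_⟩
      rw [hq]
      ring
  · intro x
    obtain ⟨u1, u2, hu⟩ := G.left_affine x
    refine ⟨u1 + (a / 2 - ε * A) * x ^ 2, u2 + (1 - τ) * A * x, fun l => ?_⟩
    simp only [left', hu]
    ring
  · intro x
    obtain ⟨u1, u2, hu⟩ := G.left_affine x
    refine ⟨(1 - τ) * u1 + (e / 2 - (1 - τ) * (ε * A)) * x ^ 2,
      (1 - τ) * u2 + (1 - τ) ^ 2 * A * x, fun l => ?_⟩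
    simp only [right', hu]
    ring
  · intro r x z
    rw [hpath_first r x z 0 (Nat.zero_le _), G.path_start]
  · intro r x z
    have := hpath_second r x z 0 (Nat.zero_le _)
    rw [G.path_start] at this
    exact this
  · intro r hr r' hr' x z heq
    -- The vertex in layer `L` is `d - x` and reveals the digit; the first half then determines `r /
    -- D`.
    have h1 := heq L (by omega)
    rw [hpath_first _ _ _ L le_rfl, hpath_first _ _ _ L le_rfl, G.path_end, G.path_end] at h1
    have h2 : r % D = r' % D := by omega
    have h3 : r / D = r' / D := by
      refine G.path_inj _ (hdiv r hr) _ (hdiv r' hr') x ((r % D : ℕ) - x) fun t ht => ?_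
      have h4 := heq t (by omega)
      rw [hpath_first _ _ _ t ht, hpath_first _ _ _ t ht, ← h2] at h4
      exact h4
    rw [← Nat.div_add_mod r D, ← Nat.div_add_mod r' D, h2, h3]
  · intro r r' hlt hr'
    have hmid : 8 * D * (ε / (8 * D)) = ε := by field_simp
    rw [hmid]
    simp only [point']
    have h1 := hmodD r
    have h2 : (0 : ℝ) ≤ ((r' % D : ℕ) : ℝ) := Nat.cast_nonneg _
    have e1 := Nat.div_add_mod r D
    have e2 := Nat.div_add_mod r' D
    rcases (Nat.div_le_div_right hlt.le : r / D ≤ r' / D).eq_or_lt with heq | hlt'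
    · rw [heq]
      have h3 : r % D + 1 ≤ r' % D := by
        rw [heq] at e1
        omega
      have h4 : ((r % D : ℕ) : ℝ) + 1 ≤ ((r' % D : ℕ) : ℝ) := by exact_mod_cast h3
      nlinarith
    · have h3 := G.point_gap _ _ hlt' (hdiv r' hr')
      nlinarith

theorem exists_pathFamily (D R : ℕ) (hD : 0 < D) (k : ℕ) :
    ∃ A ε : ℝ, 0 < A ∧ 0 < ε ∧
      Nonempty (PathFamily D R (1 / (32 * (R + 1))) (2 ^ (k + 1) - 1) (D ^ k) (k * D) A ε) := by
  induction k with
  | zero => exact ⟨1, 1, one_pos, one_pos, by simpa using exists_pathFamily_zero D R _⟩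
  | succ k ih =>
    obtain ⟨A, ε, hA, hε, ⟨G⟩⟩ := ih
    refine ⟨1 / (32 * (R + 1)) * A, ε / (8 * D), by positivity, by positivity, ?_⟩
    have e1 : 2 ^ (k + 1 + 1) - 1 = 2 * (2 ^ (k + 1) - 1) + 1 := by
      have : 0 < 2 ^ (k + 1) := by positivity
      rw [pow_succ 2 (k + 1)]
      omega
    have e2 : (((k + 1 : ℕ) : ℤ) * D) = k * D + D := by push_cast; ring
    rw [e1, e2, pow_succ]
    exact G.step hD rfl hA hε

/-- Layered graphs with `2 ^ (k + 1)` layers of width `2 * k * D + 1` in which the cheapest path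
takes `D ^ k` different courses. -/
theorem exists_parametric_shortest_paths (D k : ℕ) (hD : 0 < D) :
    ∃ (a b : ℕ → ℤ → ℤ → ℝ) (P : ℕ → ℕ → ℤ) (p : ℕ → ℝ),
      (∀ r < D ^ k, ∀ t ≤ 2 ^ (k + 1) - 1, |P r t| ≤ (k * D : ℕ)) ∧
      (∀ r, P r 0 = 0 ∧ P r (2 ^ (k + 1) - 1) = 0) ∧
      (∀ r r', r < r' → r' < D ^ k → p r < p r') ∧
      (∀ r < D ^ k, ∀ X : ℕ → ℤ, (∀ t ≤ 2 ^ (k + 1) - 1, |X t| ≤ (k * D : ℕ)) → X 0 = 0 →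
        X (2 ^ (k + 1) - 1) = 0 →
        ∑ t ∈ Finset.range (2 ^ (k + 1) - 1),
            (a t (P r t) (P r (t + 1)) + p r * b t (P r t) (P r (t + 1))) ≤
          ∑ t ∈ Finset.range (2 ^ (k + 1) - 1),
            (a t (X t) (X (t + 1)) + p r * b t (X t) (X (t + 1)))) ∧
      ∀ r < D ^ k, ∀ r' < D ^ k, r ≠ r' →
        ∑ t ∈ Finset.range (2 ^ (k + 1) - 1),
            (a t (P r t) (P r (t + 1)) + p r * b t (P r t) (P r (t + 1))) <
          ∑ t ∈ Finset.range (2 ^ (k + 1) - 1),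
            (a t (P r' t) (P r' (t + 1)) + p r * b t (P r' t) (P r' (t + 1))) := by
  -- The width equals the accumulated margin `k * D`, which leaves just enough room for both
  -- endpoints at `0`.
  obtain ⟨A, ε, hA, hε, ⟨G⟩⟩ := exists_pathFamily D (k * D) hD k
  choose a b hab using G.cost_affine
  have hD0 : (0 : ℝ) < D := by exact_mod_cast hD
  have hbd : ∀ r < D ^ k, ∀ t ≤ 2 ^ (k + 1) - 1, |G.path r 0 0 t| ≤ (k * D : ℕ) :=
    fun r hr t ht => G.path_bound r hr 0 0 (by simp) (by simp) t ht
  have hwin : ∀ r, |G.point r - G.point r| ≤ D * ε := by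
    intro r
    rw [sub_self, abs_zero]
    positivity
  refine ⟨a, b, fun r => G.path r 0 0, G.point, hbd, fun r => ⟨G.path_start .., G.path_end ..⟩,
    fun r r' h h' => ?_, fun r hr X hX h0 hL => ?_, fun r hr r' hr' hne => ?_⟩
  · have := G.point_gap r r' h h'
    have : 0 < 8 * D * ε := by positivity
    linarith
  · simp only [← hab]
    rw [G.cost_path]
    have := G.le_cost r hr _ (hwin r) X hX
    rwa [h0, hL] at this
  · simp only [← hab]
    rw [G.cost_path]
    by_contra hcon
    refine hne (G.path_inj r hr r' hr' 0 0 fun t ht => ?_)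
    have := G.eq_path r hr _ (hwin r) (G.path r' 0 0) (hbd r' hr')
    rw [G.path_start, G.path_end] at this
    exact (this (not_lt.1 hcon) t ht).symm

/-! ### Matchings, demand and critical values. -/

theorem IsBipartiteMatching.injOn_fst {V U : Type} {M : Finset (V × U)}
    (h : IsBipartiteMatching M) : Set.InjOn Prod.fst (M : Set (V × U)) := by
  intro e he e' he' heq
  by_contra hne
  exact (h e he e' he' hne).1 heq

theorem IsBipartiteMatching.injOn_snd {V U : Type} {M : Finset (V × U)}
    (h : IsBipartiteMatching M) : Set.InjOn Prod.snd (M : Set (V × U)) := by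
  intro e he e' he' heq
  by_contra hne
  exact (h e he e' he' hne).2 heq

theorem mem_matchingsIn {V U : Type} {S M : Finset (V × U)} :
    M ∈ matchingsIn S ↔ M ⊆ S ∧ IsBipartiteMatching M := by
  simp [matchingsIn]

theorem IsBipartiteMatching.card_le {V U : Type} [Fintype V] {M : Finset (V × U)}
    (h : IsBipartiteMatching M) : M.card ≤ Fintype.card V :=
  Finset.card_le_card_of_injOn (t := Finset.univ) _ (fun _ _ => Finset.mem_univ _) h.injOn_fst

namespace MatchingInstance

variable {G : MatchingInstance}

theorem setReward_of_isBipartiteMatching (hf : ∀ e ∈ G.edges, 0 ≤ G.reward e)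
    {M : Finset (G.V × G.U)} (hM : M ⊆ G.edges) (hm : IsBipartiteMatching M) :
    G.setReward M = ∑ e ∈ M, G.reward e := by
  refine le_antisymm (Finset.sup'_le _ _ fun M' hM' => ?_)
    (Finset.le_sup' (fun M => ∑ e ∈ M, G.reward e) (mem_matchingsIn.2 ⟨subset_rfl, hm⟩))
  have h := (mem_matchingsIn.1 hM').1
  exact Finset.sum_le_sum_of_subset_of_nonneg h fun e he _ => hf e (hM he)

theorem agentUtility_of_isBipartiteMatching (hf : ∀ e ∈ G.edges, 0 ≤ G.reward e)
    {M : Finset (G.V × G.U)} (hM : M ⊆ G.edges) (hm : IsBipartiteMatching M) (a : ℝ) :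
    G.agentUtility a M = ∑ e ∈ M, G.weight a e := by
  simp only [agentUtility, setCost, weight, setReward_of_isBipartiteMatching hf hM hm,
    Finset.sum_sub_distrib, Finset.mul_sum]

/-- With non-negative costs, the agent need not choose anything but a matching. -/
theorem exists_matching_subset (hf : ∀ e ∈ G.edges, 0 ≤ G.reward e)
    (hc : ∀ e ∈ G.edges, 0 ≤ G.cost e) {S : Finset (G.V × G.U)} (hS : S ⊆ G.edges) :
    ∃ M ⊆ S, IsBipartiteMatching M ∧ G.setReward M = G.setReward S ∧
      ∀ a, G.agentUtility a S ≤ G.agentUtility a M := by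
  obtain ⟨M, hM, hSM⟩ := Finset.exists_mem_eq_sup' (matchingsIn_nonempty S)
    fun M => ∑ e ∈ M, G.reward e
  obtain ⟨hMS, hm⟩ := mem_matchingsIn.1 hM
  have heq : G.setReward M = G.setReward S :=
    (setReward_of_isBipartiteMatching hf (hMS.trans hS) hm).trans hSM.symm
  refine ⟨M, hMS, hm, heq, fun a => ?_⟩
  have : G.setCost M ≤ G.setCost S :=
    Finset.sum_le_sum_of_subset_of_nonneg hMS fun e he _ => hc e (hS he)
  simp only [agentUtility, heq]
  linarith

theorem IsMaxWeightMatching.mem_demand (hf : ∀ e ∈ G.edges, 0 ≤ G.reward e)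
    (hc : ∀ e ∈ G.edges, 0 ≤ G.cost e) {a : ℝ} {M : Finset (G.V × G.U)}
    (h : G.IsMaxWeightMatching a M) : M ∈ G.demand a := by
  refine ⟨h.1, fun T hT => ?_⟩
  obtain ⟨M', hM'T, hm', -, hu⟩ := exists_matching_subset hf hc hT
  refine (hu a).trans ?_
  rw [agentUtility_of_isBipartiteMatching hf (hM'T.trans hT) hm',
    agentUtility_of_isBipartiteMatching hf h.1 h.2.1]
  exact h.2.2 M' (hM'T.trans hT) hm'

theorem isMaxWeightMatching_of_mem_demand (hf : ∀ e ∈ G.edges, 0 ≤ G.reward e)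
    {a : ℝ} {M : Finset (G.V × G.U)} (hm : IsBipartiteMatching M) (h : M ∈ G.demand a) :
    G.IsMaxWeightMatching a M := by
  refine ⟨h.1, hm, fun M' hM' hm' => ?_⟩
  have := h.2 M' hM'
  rwa [agentUtility_of_isBipartiteMatching hf hM' hm',
    agentUtility_of_isBipartiteMatching hf h.1 hm] at this

/-- The utility difference of two fixed sets is affine in the contract, so it is non-negative
between two points where it is non-negative. -/
theorem mem_demand_of_mem_Icc {a b x : ℝ} {S : Finset (G.V × G.U)} (ha : S ∈ G.demand a)
    (hb : S ∈ G.demand b) (hx : x ∈ Set.Icc a b) : S ∈ G.demand x := by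
  refine ⟨ha.1, fun T hT => ?_⟩
  have h1 := ha.2 T hT
  have h2 := hb.2 T hT
  simp only [agentUtility] at *
  rcases le_total (G.setReward T) (G.setReward S) with h | h
  · nlinarith [hx.1]
  · nlinarith [hx.2]

theorem exists_isMaxWeightMatching_mem_bestResponse (hf : ∀ e ∈ G.edges, 0 ≤ G.reward e)
    (hc : ∀ e ∈ G.edges, 0 ≤ G.cost e) {a : ℝ} {M₀ : Finset (G.V × G.U)}
    (h₀ : G.IsMaxWeightMatching a M₀) :
    ∃ M, G.IsMaxWeightMatching a M ∧ M ∈ G.bestResponse a := by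
  have hfin : {M | G.IsMaxWeightMatching a M}.Finite :=
    (G.edges.powerset.finite_toSet).subset fun M hM => by
      simpa using (show M ⊆ G.edges from hM.1)
  obtain ⟨M, hM, hmax⟩ := hfin.exists_maximalFor G.setReward _ ⟨M₀, h₀⟩
  have hMd := hM.mem_demand hf hc
  refine ⟨M, hM, hMd, fun T hT => ?_⟩
  obtain ⟨M', hM'T, hm', hr, hu⟩ := exists_matching_subset hf hc hT.1
  have hM' : M' ∈ G.demand a := ⟨hM'T.trans hT.1, fun S hS => (hT.2 S hS).trans (hu a)⟩
  rw [← hr]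
  by_contra hlt
  exact hlt (hmax (isMaxWeightMatching_of_mem_demand hf hm' hM') (not_le.1 hlt).le)

/-- The contracts at which `S` is demanded form a closed set, and its least point `x` in `[a, b]` is
critical because `S` is not demanded on `[a, x)`. Tie breaking also favors `S` at `x < b`: a
demanded set of higher reward would overtake `S` by `b`. -/
theorem exists_isCriticalValue {a b : ℝ} (ha : 0 ≤ a) (hab : a ≤ b) (hb : b ≤ 1)
    {S : Finset (G.V × G.U)} (hSb : S ∈ G.bestResponse b) (hSa : S ∉ G.demand a) :
    ∃ x ∈ Set.Ioc a b, G.IsCriticalValue x ∧ S ∈ G.bestResponse x := by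
  have hclosed : IsClosed {x : ℝ | S ∈ G.demand x} := by
    have : {x : ℝ | S ∈ G.demand x} = ⋂ (T) (_ : T ⊆ G.edges),
        {x | S ⊆ G.edges ∧ G.agentUtility x T ≤ G.agentUtility x S} := by
      ext x
      simp only [Set.mem_ofPred_eq, Set.mem_iInter, demand]
      exact ⟨fun h T hT => ⟨h.1, h.2 T hT⟩,
        fun h => ⟨(h ∅ (Finset.empty_subset _)).1, fun T hT => (h T hT).2⟩⟩
    rw [this]
    refine isClosed_iInter fun T => isClosed_iInter fun _ => ?_
    refine IsClosed.and isClosed_const (isClosed_le ?_ ?_)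
    · simp only [agentUtility]
      fun_prop
    · simp only [agentUtility]
      fun_prop
  obtain ⟨x, ⟨⟨hax, hxb⟩, hx⟩, hmin⟩ := (isCompact_Icc.inter_right hclosed).exists_isLeast
    ⟨b, ⟨hab, le_rfl⟩, hSb.1⟩
  have hax' : a < x := lt_of_le_of_ne hax fun h => hSa (h ▸ hx)
  have hbest : S ∈ G.bestResponse x := by
    refine ⟨hx, fun T hT => ?_⟩
    rcases hxb.eq_or_lt with rfl | hlt
    · exact hSb.2 T hT
    · have h1 := hT.2 S hx.1
      have h2 := hSb.1.2 T hT.1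
      simp only [agentUtility] at h1 h2
      nlinarith
  refine ⟨x, ⟨hax', hxb⟩, ⟨⟨ha.trans hax, hxb.trans hb⟩, fun β hβ => ?_⟩, hbest⟩
  refine ⟨max β a, ⟨le_max_left _ _, max_lt hβ.2 hax'⟩, fun heq => ?_⟩
  have hmem : S ∈ G.bestResponse (max β a) := heq ▸ hbest
  exact absurd (hmin ⟨⟨le_max_right _ _, (max_lt hβ.2 hax').le.trans hxb⟩, hmem.1⟩)
    (not_le.2 (max_lt hβ.2 hax'))

/-- Each gap between consecutive sample contracts contributes a critical value, so `N` samples yield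
the indices from `2` to `N`. The matching chosen at index `i` is a best response at `a (i - 1)`, not
necessarily the given `M (i - 1)`. -/
theorem exists_critical_values (hf : ∀ e ∈ G.edges, 0 ≤ G.reward e)
    (hc : ∀ e ∈ G.edges, 0 ≤ G.cost e) {N : ℕ} {a : ℕ → ℝ}
    (ha : ∀ r < N, a r ∈ Set.Icc (0 : ℝ) 1) (hmono : ∀ r r', r < r' → r' < N → a r < a r')
    {M : ℕ → Finset (G.V × G.U)} (hM : ∀ r < N, G.IsMaxWeightMatching (a r) (M r))
    (hM' : ∀ r, r + 1 < N → ¬ G.IsMaxWeightMatching (a r) (M (r + 1))) :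
    ∃ (α : ℕ → ℝ) (M' : ℕ → Finset (G.V × G.U)),
      (∀ i ∈ Set.Icc 2 N, α i ∈ Set.Ioc (a (i - 2)) (a (i - 1)) ∧ G.IsCriticalValue (α i) ∧
        G.IsMaxWeightMatching (α i) (M' i) ∧ M' i ∈ G.bestResponse (α i)) ∧
      Set.InjOn M' (Set.Icc 2 N) := by
  have hex : ∀ i, ∃ (x : ℝ) (T : Finset (G.V × G.U)), i ∈ Set.Icc 2 N →
      x ∈ Set.Ioc (a (i - 2)) (a (i - 1)) ∧ G.IsCriticalValue x ∧
        G.IsMaxWeightMatching x T ∧ T ∈ G.bestResponse x ∧ T ∈ G.demand (a (i - 1)) ∧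
        T ∉ G.demand (a (i - 2)) := by
    intro i
    by_cases hi : i ∈ Set.Icc 2 N
    swap
    · exact ⟨0, ∅, fun h => absurd h hi⟩
    obtain ⟨r, rfl⟩ : ∃ r, i = r + 2 := ⟨i - 2, by have := hi.1; omega⟩
    have hr : r + 1 < N := by have := hi.2; omega
    have e1 : r + 2 - 2 = r := by omega
    have e2 : r + 2 - 1 = r + 1 := by omega
    rw [e1, e2]
    obtain ⟨T, hT, hTb⟩ := exists_isMaxWeightMatching_mem_bestResponse hf hc (hM (r + 1) hr)
    have hlt := hmono r (r + 1) (by omega) hr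
    -- At `a (r + 1)`, `T` ties with `M (r + 1)` in utility and has at least its reward. Lowering
    -- the contract therefore hurts `T` at least as much, so demand for `T` at `a r` would make `M
    -- (r + 1)` optimal there.
    have hTa : T ∉ G.demand (a r) := by
      intro hTa
      have h1 := (hM (r + 1) hr).mem_demand hf hc
      have h2 : ¬ G.agentUtility (a r) T ≤ G.agentUtility (a r) (M (r + 1)) := fun hle =>
        hM' r hr (isMaxWeightMatching_of_mem_demand hf (hM (r + 1) hr).2.1
          ⟨(hM (r + 1) hr).1, fun S hS => (hTa.2 S hS).trans hle⟩)
      have h3 := hTb.2 _ h1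
      have h4 := h1.2 T hT.1
      simp only [agentUtility] at h2 h4
      nlinarith
    obtain ⟨x, hx, hcrit, hbest⟩ := exists_isCriticalValue (ha r (by omega)).1 hlt.le
      (ha (r + 1) hr).2 hTb hTa
    exact ⟨x, T, fun _ => ⟨hx, hcrit, isMaxWeightMatching_of_mem_demand hf hT.2.1 hbest.1, hbest,
      hTb.1, hTa⟩⟩
  choose α M' h using hex
  refine ⟨α, M', fun i hi => ⟨(h i hi).1, (h i hi).2.1, (h i hi).2.2.1, (h i hi).2.2.2.1⟩, ?_⟩
  have hne : ∀ i ∈ Set.Icc 2 N, ∀ j ∈ Set.Icc 2 N, i < j → M' i ≠ M' j := by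
    intro i hi j hj hij heq
    obtain ⟨hα, -, -, hbest, -⟩ := h i hi
    obtain ⟨-, -, -, -, hd, hnd⟩ := h j hj
    -- A repeated matching would be demanded at `α i` and at `a (j - 1)`, hence at `a (j - 2)` in
    -- between, where the `j`-th choice is not demanded.
    refine hnd (mem_demand_of_mem_Icc (heq ▸ hbest.1) hd ⟨hα.2.trans ?_, ?_⟩)
    · have h1 := hi.1
      rcases (show i - 1 ≤ j - 2 by omega).eq_or_lt with h' | h'
      · rw [h']
      · exact (hmono _ _ h' (by have := hj.2; omega)).le
    · exact (hmono _ _ (by have := hj.1; omega) (by have := hj.2; have := hj.1; omega)).le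
  intro i hi j hj heq
  rcases lt_trichotomy i j with hij | hij | hij
  · exact absurd heq (hne i hi j hj hij)
  · exact hij
  · exact absurd heq.symm (hne j hj i hi hij)

end MatchingInstance

/-! ### From parametric matching costs to contracts. -/

theorem exists_perturbed_instance {V : Type} [Fintype V] (E : Finset (V × V)) (a b : V × V → ℝ)
    {N : ℕ} (hN : 2 ≤ N) {p : ℕ → ℝ} (hp : ∀ r r', r < r' → r' < N → p r < p r')
    {M : ℕ → Finset (V × V)} (hME : ∀ r < N, M r ⊆ E)
    (hMm : ∀ r < N, IsBipartiteMatching (M r)) (hMc : ∀ r < N, (M r).card = Fintype.card V)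
    (hMmin : ∀ r < N, ∀ M' ⊆ E, IsBipartiteMatching M' → M'.card = Fintype.card V →
      ∑ e ∈ M r, (a e + p r * b e) ≤ ∑ e ∈ M', (a e + p r * b e))
    (hMlt : ∀ r, r + 1 < N →
      ∑ e ∈ M r, (a e + p r * b e) < ∑ e ∈ M (r + 1), (a e + p r * b e)) :
    ∃ (G : MatchingInstance) (Q : ℝ) (α : ℕ → ℝ),
      Fintype.card G.V = Fintype.card V ∧ Fintype.card G.U = Fintype.card V ∧
        0 < α 2 ∧ StrictMonoOn α (Set.Icc 2 N) ∧ α N < Q ∧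
        (∀ e ∈ G.edges, 0 ≤ G.reward e ∧ 0 ≤ G.cost e) ∧
        (∀ S ⊆ G.edges, G.setReward S ∈ Set.Icc (0 : ℝ) 1) ∧
        (∀ x ∈ Set.Icc (α 2) Q, ∀ e ∈ G.edges, 0 ≤ G.weight x e) ∧
        (∀ i ∈ Set.Icc 2 N, G.IsCriticalValue (α i) ∧
          ∀ M, G.IsMaxWeightMatching (α i) M → G.IsPerfectMatching M) ∧
        ∃ M : ℕ → Finset (G.V × G.U),
          (∀ i ∈ Set.Icc 2 N, G.IsMaxWeightMatching (α i) (M i) ∧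
            M i ∈ G.bestResponse (α i)) ∧
          Set.InjOn M (Set.Icc 2 N) := by
  obtain ⟨C, hC1, hCa, hCb, hCp⟩ : ∃ C : ℝ, 1 ≤ C ∧ (∀ e ∈ E, |a e| ≤ C) ∧ (∀ e ∈ E, |b e| ≤ C) ∧
      ∀ r < N, |p r| ≤ C := by
    have ha : ∀ e ∈ E, |a e| ≤ ∑ e ∈ E, |a e| := fun e he =>
      Finset.single_le_sum (f := fun e => |a e|) (fun _ _ => abs_nonneg _) he
    have hb : ∀ e ∈ E, |b e| ≤ ∑ e ∈ E, |b e| := fun e he =>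
      Finset.single_le_sum (f := fun e => |b e|) (fun _ _ => abs_nonneg _) he
    have hp : ∀ r < N, |p r| ≤ ∑ r ∈ Finset.range N, |p r| := fun r hr =>
      Finset.single_le_sum (f := fun r => |p r|) (fun _ _ => abs_nonneg _) (Finset.mem_range.2 hr)
    have h1 : 0 ≤ ∑ e ∈ E, |a e| := Finset.sum_nonneg fun _ _ => abs_nonneg _
    have h2 : 0 ≤ ∑ e ∈ E, |b e| := Finset.sum_nonneg fun _ _ => abs_nonneg _
    have h3 : 0 ≤ ∑ r ∈ Finset.range N, |p r| := Finset.sum_nonneg fun _ _ => abs_nonneg _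
    exact ⟨1 + ∑ e ∈ E, |a e| + ∑ e ∈ E, |b e| + ∑ r ∈ Finset.range N, |p r|, by linarith,
      fun e he => by linarith [ha e he], fun e he => by linarith [hb e he],
      fun r hr => by linarith [hp r hr]⟩
  obtain ⟨n, hn⟩ : ∃ n : ℕ, n = Fintype.card V := ⟨_, rfl⟩
  rw [← hn] at hMc hMmin
  have hn0 : (0 : ℝ) ≤ n := n.cast_nonneg
  -- Rewards are at most `2 * φ`, so a matching earns at most `1`. With `δ` of order `1 / n`, the
  -- perturbations along a whole matching add up to less than the weight of one edge.
  obtain ⟨φ, hφ⟩ : ∃ φ : ℝ, φ = 1 / (2 * (n + 1)) := ⟨_, rfl⟩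
  obtain ⟨δ, hδ⟩ : ∃ δ : ℝ, δ = 1 / (16 * (n + 1)) := ⟨_, rfl⟩
  obtain ⟨s, hs⟩ : ∃ s : ℝ, s = φ * δ / C := ⟨_, rfl⟩
  have hφ0 : 0 < φ := by rw [hφ]; positivity
  have hδ0 : 0 < δ := by rw [hδ]; positivity
  have hC0 : 0 < C := by linarith
  have hs0 : 0 < s := by rw [hs]; positivity
  have hsC : s * C = φ * δ := by rw [hs]; field_simp
  have hφn : φ * (n + 1) = 1 / 2 := by rw [hφ]; field_simp
  have hδn : δ * (n + 1) = 1 / 16 := by rw [hδ]; field_simp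
  have hδ1 : δ ≤ 1 / 16 := by nlinarith
  have hsb : ∀ e ∈ E, |s * b e| ≤ φ * δ := by
    intro e he
    rw [abs_mul, abs_of_pos hs0, ← hsC]
    exact mul_le_mul_of_nonneg_left (hCb e he) hs0.le
  have hsa : ∀ e ∈ E, |s / (8 * C) * a e| ≤ φ * δ / 8 := by
    intro e he
    rw [abs_mul, abs_of_pos (by positivity)]
    calc s / (8 * C) * |a e| ≤ s / (8 * C) * C := by gcongr; exact hCa e he
      _ = s * 1 / 8 := by field_simp
      _ ≤ s * C / 8 := by gcongr
      _ = φ * δ / 8 := by rw [hsC]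
  have hφδ : φ * δ ≤ φ / 16 := by nlinarith
  -- At the contract `3 / 4 + l / (8 * C)` the weight of `e` is `φ * (x - 1 / 4) - s / (8 * C) * (a
  -- e + l * b e)`, with `x` the contract: a constant minus a multiple of the parametric cost.
  let G : MatchingInstance :=
    { V := V, U := V, edges := E, reward := fun e => φ - s * b e
      cost := fun e => φ / 4 - 3 / 4 * (s * b e) + s / (8 * C) * a e }
  have hpos : ∀ e ∈ G.edges, 0 ≤ G.reward e ∧ 0 ≤ G.cost e := by
    intro e he
    have h1 := abs_le.1 (hsb e he)
    have h2 := abs_le.1 (hsa e he)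
    have h3 : 0 ≤ φ - s * b e := by linarith
    have h4 : 0 ≤ φ / 4 - 3 / 4 * (s * b e) + s / (8 * C) * a e := by linarith
    exact ⟨h3, h4⟩
  have hweight : ∀ x ∈ Set.Icc (5 / 8 : ℝ) (15 / 16), ∀ e ∈ E,
      |G.weight x e - φ * (x - 1 / 4)| ≤ φ * δ := by
    intro x hx e he
    have h1 := abs_le.1 (hsb e he)
    have h2 := abs_le.1 (hsa e he)
    have h3 : G.weight x e - φ * (x - 1 / 4) =
        -((x - 3 / 4) * (s * b e)) - s / (8 * C) * a e := by
      change x * (φ - s * b e) - (φ / 4 - 3 / 4 * (s * b e) + s / (8 * C) * a e) - _ = _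
      ring
    have h4 : |(x - 3 / 4) * (s * b e)| ≤ 3 / 16 * (φ * δ) := by
      rw [abs_mul]
      exact mul_le_mul (abs_le.2 ⟨by linarith [hx.1], by linarith [hx.2]⟩) (hsb e he)
        (abs_nonneg _) (by norm_num)
    have h4 := abs_le.1 h4
    rw [h3, abs_le]
    constructor <;> linarith
  -- matchings that are not perfect are far from optimal
  have hsmall : ∀ x ∈ Set.Icc (5 / 8 : ℝ) (15 / 16), ∀ T ⊆ E, T.card = n → ∀ M' ⊆ E,
      M'.card < n → ∑ e ∈ M', G.weight x e < ∑ e ∈ T, G.weight x e := by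
    intro x hx T hT hTc M' hM' hc
    have h1 : ∑ e ∈ M', G.weight x e ≤ M'.card • (φ * (x - 1 / 4) + φ * δ) :=
      Finset.sum_le_card_nsmul _ _ _ fun e he => by
        have := (abs_le.1 (hweight x hx e (hM' he))).2
        linarith
    have h2 : T.card • (φ * (x - 1 / 4) - φ * δ) ≤ ∑ e ∈ T, G.weight x e :=
      Finset.card_nsmul_le_sum _ _ _ fun e he => by
        have := (abs_le.1 (hweight x hx e (hT he))).1
        linarith
    rw [nsmul_eq_mul] at h1 h2
    rw [hTc] at h2
    have h3 : (M'.card : ℝ) + 1 ≤ n := by exact_mod_cast hc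
    have h4 : 3 / 8 * φ ≤ φ * (x - 1 / 4) := by nlinarith [hx.1]
    have h5 : φ * δ * n ≤ φ / 16 := by
      have : φ * δ * (n + 1) = φ / 16 := by rw [mul_assoc, hδn]; ring
      nlinarith
    have h6 : (M'.card : ℝ) * (φ * (x - 1 / 4) + φ * δ) ≤
        (n - 1) * (φ * (x - 1 / 4) + φ * δ) :=
      mul_le_mul_of_nonneg_right (by linarith) (by nlinarith)
    nlinarith
  have hperfect : ∀ x ∈ Set.Icc (5 / 8 : ℝ) (15 / 16), ∀ T,
      G.IsMaxWeightMatching x T → G.IsPerfectMatching T := by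
    intro x hx T hT
    classical
    have hc : T.card = Fintype.card V := by
      refine le_antisymm hT.2.1.card_le (not_lt.1 fun hlt => ?_)
      exact absurd (hT.2.2 (M 0) (hME 0 (by omega)) (hMm 0 (by omega)))
        (not_le.2 (hsmall x hx _ (hME 0 (by omega)) (hMc 0 (by omega)) T hT.1 (hn ▸ hlt)))
    refine ⟨hT.1, hT.2.1, fun v => ?_, fun u => ?_⟩
    · have h1 : T.image Prod.fst = (Finset.univ : Finset V) := Finset.eq_univ_of_card _
        ((Finset.card_image_of_injOn hT.2.1.injOn_fst).trans hc)
      have h2 : v ∈ T.image Prod.fst := h1 ▸ Finset.mem_univ (α := V) v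
      simpa using Finset.mem_image.1 h2
    · have h1 : T.image Prod.snd = (Finset.univ : Finset V) := Finset.eq_univ_of_card _
        ((Finset.card_image_of_injOn hT.2.1.injOn_snd).trans hc)
      have h2 : u ∈ T.image Prod.snd := h1 ▸ Finset.mem_univ (α := V) u
      simpa using Finset.mem_image.1 h2
  let x : ℕ → ℝ := fun r => 3 / 4 + p r / (8 * C)
  have hxr : ∀ r < N, x r ∈ Set.Icc (5 / 8 : ℝ) (7 / 8) := by
    intro r hr
    have h1 : |p r / (8 * C)| ≤ 1 / 8 := by
      rw [abs_div, abs_of_pos (by positivity : 0 < 8 * C), div_le_iff₀ (by positivity)]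
      linarith [hCp r hr]
    have h1 := abs_le.1 h1
    constructor <;> simp only [x] <;> linarith
  have hxr' : ∀ r < N, x r ∈ Set.Icc (5 / 8 : ℝ) (15 / 16) := fun r hr =>
    ⟨(hxr r hr).1, (hxr r hr).2.trans (by norm_num)⟩
  have hsum : ∀ r, ∀ T : Finset (V × V), ∑ e ∈ T, G.weight (x r) e =
      T.card * (φ * (x r - 1 / 4)) - s / (8 * C) * ∑ e ∈ T, (a e + p r * b e) := by
    intro r T
    rw [Finset.mul_sum, ← nsmul_eq_mul, ← Finset.sum_const, ← Finset.sum_sub_distrib]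
    refine Finset.sum_congr rfl fun e _ => ?_
    change x r * (φ - s * b e) - (φ / 4 - 3 / 4 * (s * b e) + s / (8 * C) * a e) = _
    simp only [x]
    ring
  have hmax : ∀ r < N, G.IsMaxWeightMatching (x r) (M r) := by
    intro r hr
    refine ⟨hME r hr, hMm r hr, fun M' hM' hm' => ?_⟩
    rcases (hn ▸ hm'.card_le : M'.card ≤ n).eq_or_lt with hc | hc
    · refine ((hsum r M').trans_le ?_).trans (hsum r (M r)).ge
      rw [hc, hMc r hr]
      have := mul_le_mul_of_nonneg_left (hMmin r hr M' hM' hm' hc)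
        (by positivity : 0 ≤ s / (8 * C))
      linarith
    · exact (hsmall _ (hxr' r hr) _ (hME r hr) (hMc r hr) M' hM' hc).le
  have hnmax : ∀ r, r + 1 < N → ¬ G.IsMaxWeightMatching (x r) (M (r + 1)) := by
    intro r hr h
    have h1 := h.2.2 (M r) (hME r (by omega)) (hMm r (by omega))
    have h2 := (hsum r (M r)).symm.trans_le (h1.trans_eq (hsum r (M (r + 1))))
    rw [hMc r (by omega), hMc (r + 1) hr] at h2
    have := mul_lt_mul_of_pos_left (hMlt r hr) (by positivity : 0 < s / (8 * C))
    linarith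
  obtain ⟨α, M', hα, hinj⟩ := MatchingInstance.exists_critical_values (G := G) (a := x)
    (fun e he => (hpos e he).1) (fun e he => (hpos e he).2)
    (fun r hr => ⟨by linarith [(hxr r hr).1], by linarith [(hxr r hr).2]⟩)
    (fun r r' h h' => by
      simp only [x]
      gcongr
      exact hp r r' h h') hmax hnmax
  have hαr : ∀ i ∈ Set.Icc 2 N, α i ∈ Set.Icc (5 / 8 : ℝ) (7 / 8) := by
    intro i hi
    have h1 := hi.1
    have h2 := hi.2
    exact ⟨(hxr (i - 2) (by omega)).1.trans (hα i hi).1.1.le,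
      (hα i hi).1.2.trans (hxr (i - 1) (by omega)).2⟩
  have h2N : 2 ∈ Set.Icc 2 N := ⟨le_rfl, hN⟩
  have hNN : N ∈ Set.Icc 2 N := ⟨hN, le_rfl⟩
  refine ⟨G, 15 / 16, α, rfl, rfl, by linarith [(hαr 2 h2N).1], ?_, by linarith [(hαr N hNN).2],
    hpos, ?_, ?_, fun i hi => ⟨(hα i hi).2.1, hperfect _ ?_⟩, M',
    fun i hi => (hα i hi).2.2, hinj⟩
  · intro i hi j hj hij
    refine (hα i hi).1.2.trans_lt (lt_of_le_of_lt ?_ (hα j hj).1.1)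
    have h1 := hi.1
    have h2 := hj.2
    rcases (show i - 1 ≤ j - 2 by omega).eq_or_lt with h' | h'
    · rw [h']
    · have := hp _ _ h' (by omega)
      simp only [x]
      gcongr
  · intro S hS
    obtain ⟨T, hT, hTm, hTS, -⟩ := MatchingInstance.exists_matching_subset
      (fun e he => (hpos e he).1) (fun e he => (hpos e he).2) hS
    rw [← hTS, MatchingInstance.setReward_of_isBipartiteMatching (fun e he => (hpos e he).1)
      (hT.trans hS) hTm]
    refine ⟨Finset.sum_nonneg fun e he => (hpos e (hS (hT he))).1, ?_⟩
    have h1 : ∑ e ∈ T, G.reward e ≤ T.card • (2 * φ) :=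
      Finset.sum_le_card_nsmul _ _ _ fun e he => by
        have := (abs_le.1 (hsb e (hS (hT he)))).1
        change φ - s * b e ≤ 2 * φ
        linarith
    have h2 : (T.card : ℝ) ≤ n := by
      rw [hn]
      exact_mod_cast hTm.card_le
    refine h1.trans ?_
    rw [nsmul_eq_mul]
    nlinarith
  · intro y hy e he
    have hy' : y ∈ Set.Icc (5 / 8 : ℝ) (15 / 16) := ⟨(hαr 2 h2N).1.trans hy.1, hy.2⟩
    have h1 := (abs_le.1 (hweight y hy' e he)).1
    nlinarith [hy'.1]
  · exact ⟨(hαr i hi).1, (hαr i hi).2.trans (by norm_num)⟩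

/-! ### Layered paths as perfect matchings. -/

/-- The edges of a layered graph, closed up by the edge from `(L, o)` to `(0, o)`, and with a loop
at every other vertex. -/
def layeredEdges {W : Type} [Fintype W] [DecidableEq W] (L : ℕ) (o : W) :
    Finset ((Fin (L + 1) × W) × (Fin (L + 1) × W)) :=
  Finset.univ.filter fun e => (e.1 = e.2 ∧ e.1 ≠ (0, o) ∧ e.1 ≠ (Fin.last L, o)) ∨
    (e.1.1 : ℕ) + 1 = e.2.1 ∨ (e.1 = (Fin.last L, o) ∧ e.2 = (0, o))

/-- The cost of an edge between consecutive layers; all other edges are free. In the first layer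
only the vertex `o` matters. -/
def layeredCost {W : Type} {L : ℕ} (o : W) (c : ℕ → W → W → ℝ)
    (e : (Fin (L + 1) × W) × (Fin (L + 1) × W)) : ℝ :=
  if (e.1.1 : ℕ) + 1 = e.2.1 then c e.1.1 (if (e.1.1 : ℕ) = 0 then o else e.1.2) e.2.2 else 0

/-- The matching that belongs to a path through the layers. -/
def pathMatching {W : Type} [Fintype W] [DecidableEq W] (L : ℕ) (X : ℕ → W) :
    Finset ((Fin (L + 1) × W) × (Fin (L + 1) × W)) :=
  Finset.univ.image fun v => (v, if v.2 = X v.1 then (v.1 + 1, X (v.1 + 1 : Fin (L + 1))) else v)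

section

variable {W : Type} [Fintype W] {L : ℕ} {o : W}

theorem pathMatching_subset [DecidableEq W] {X : ℕ → W} (h0 : X 0 = o) (hL : X L = o) :
    pathMatching L X ⊆ layeredEdges L o := by
  intro e he
  obtain ⟨⟨t, x⟩, -, rfl⟩ := Finset.mem_image.1 he
  simp only [layeredEdges, Finset.mem_filter, Finset.mem_univ, true_and]
  by_cases hx : x = X t
  · simp only [hx, if_true]
    right
    -- Addition in `Fin (L + 1)` wraps around, so the successor of the last layer is layer `0` and
    -- yields the back edge.
    rcases Fin.eq_castSucc_or_eq_last t with ⟨t, rfl⟩ | rfl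
    · left
      simp
    · right
      simp [h0, hL]
  · left
    simp only [hx, if_false, true_and, ne_eq, Prod.mk.injEq, not_and]
    constructor
    · rintro rfl rfl
      exact hx h0.symm
    · rintro rfl rfl
      exact hx hL.symm

theorem isBipartiteMatching_pathMatching [DecidableEq W] (X : ℕ → W) :
    IsBipartiteMatching (pathMatching L X) := by
  intro e he e' he' hne
  obtain ⟨v, -, rfl⟩ := Finset.mem_image.1 he
  obtain ⟨v', -, rfl⟩ := Finset.mem_image.1 he'
  have hv : v ≠ v' := fun h => hne (by rw [h])
  refine ⟨hv, fun h => hv ?_⟩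
  obtain ⟨t, x⟩ := v
  obtain ⟨t', x'⟩ := v'
  simp only at h
  split_ifs at h with h1 h2 h2
  · have := add_right_cancel (Prod.mk.inj h).1
    subst this
    rw [h1, h2]
  · obtain ⟨h3, h4⟩ := Prod.mk.inj h
    exact absurd (by rw [← h4, h3]) h2
  · obtain ⟨h3, h4⟩ := Prod.mk.inj h
    exact absurd (by rw [h4, h3]) h1
  · exact h

theorem sum_pathMatching [DecidableEq W] (X : ℕ → W) (f : (Fin (L + 1) × W) × (Fin (L + 1) × W) → ℝ) :
    ∑ e ∈ pathMatching L X, f e =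
      ∑ v, f (v, if v.2 = X v.1 then (v.1 + 1, X (v.1 + 1 : Fin (L + 1))) else v) :=
  Finset.sum_image fun _ _ _ _ h => (Prod.mk.inj h).1

theorem card_pathMatching [DecidableEq W] (X : ℕ → W) :
    (pathMatching L X).card = Fintype.card (Fin (L + 1) × W) :=
  Finset.card_image_of_injective _ fun _ _ h => (Prod.mk.inj h).1

theorem sum_layeredCost_pathMatching [DecidableEq W] {X : ℕ → W} (h0 : X 0 = o) (c : ℕ → W → W → ℝ) :
    ∑ e ∈ pathMatching L X, layeredCost o c e =
      ∑ t ∈ Finset.range L, c t (X t) (X (t + 1)) := by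
  rw [sum_pathMatching, Fintype.sum_prod_type, Finset.sum_range]
  have h1 : ∀ t : Fin (L + 1), ∑ x : W, layeredCost o c ((t, x),
      if x = X t then (t + 1, X (t + 1 : Fin (L + 1))) else (t, x)) =
      layeredCost o c ((t, X t), (t + 1, X (t + 1 : Fin (L + 1)))) := by
    intro t
    rw [Finset.sum_eq_single (X t)]
    · simp
    · intro x _ hx
      simp [hx, layeredCost]
    · simp
  simp only [h1]
  rw [Fin.sum_univ_castSucc]
  have h2 : layeredCost o c ((Fin.last L, X (Fin.last L : Fin (L + 1))),
      (Fin.last L + 1, X (Fin.last L + 1 : Fin (L + 1)))) = 0 := by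
    simp [layeredCost]
  rw [h2, add_zero]
  refine Finset.sum_congr rfl fun t _ => ?_
  have h3 : ((t.castSucc + 1 : Fin (L + 1)) : ℕ) = t + 1 := by simp
  simp only [layeredCost, h3, Fin.val_castSucc, if_true]
  split_ifs with h
  · rw [h, h0]
  · rfl

/-- The least cost of a path to a vertex of layer `t` from the first layer. -/
def layerDist (o : W) (c : ℕ → W → W → ℝ) : ℕ → W → ℝ
  | 0, _ => 0
  | t + 1, y => Finset.univ.inf' ⟨o, Finset.mem_univ o⟩ fun x =>
      layerDist o c t x + c t (if t = 0 then o else x) y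

theorem exists_path_eq_layerDist (c : ℕ → W → W → ℝ) (t : ℕ) (y : W) :
    ∃ X : ℕ → W, X t = y ∧ layerDist o c t y =
      ∑ i ∈ Finset.range t, c i (if i = 0 then o else X i) (X (i + 1)) := by
  induction t generalizing y with
  | zero => exact ⟨fun _ => y, rfl, by simp [layerDist]⟩
  | succ t ih =>
    obtain ⟨x, -, hx⟩ := Finset.exists_mem_eq_inf' (⟨o, Finset.mem_univ o⟩ : Finset.univ.Nonempty)
      fun x => layerDist o c t x + c t (if t = 0 then o else x) y
    obtain ⟨X, hX, hd⟩ := ih x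
    refine ⟨fun i => if i ≤ t then X i else y, by simp, ?_⟩
    rw [layerDist, hx, hd, Finset.sum_range_succ]
    congr 1
    · refine Finset.sum_congr rfl fun i hi => ?_
      have := Finset.mem_range.1 hi
      simp [this.le, Nat.succ_le_of_lt this]
    · simp [hX]

/-- Shortest distances from the first layer serve as a potential. A perfect matching meets every
vertex once as source and once as target, so passing to reduced costs does not change its total.
Reduced costs are non-negative except possibly on the back edge, whose reduced cost is the shortest
distance to `(L, o)`. No cycle decomposition is needed. -/
theorem exists_path_le_sum_layeredCost [DecidableEq W] (hL : 0 < L) (c : ℕ → W → W → ℝ)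
    {M : Finset ((Fin (L + 1) × W) × (Fin (L + 1) × W))} (hM : M ⊆ layeredEdges L o)
    (hm : IsBipartiteMatching M) (hc : M.card = Fintype.card (Fin (L + 1) × W)) :
    ∃ X : ℕ → W, X 0 = o ∧ X L = o ∧
      ∑ t ∈ Finset.range L, c t (X t) (X (t + 1)) ≤ ∑ e ∈ M, layeredCost o c e := by
  let p : Fin (L + 1) × W → ℝ := fun v => layerDist o c v.1 v.2
  have hfst : M.image Prod.fst = Finset.univ := Finset.eq_univ_of_card _
    ((Finset.card_image_of_injOn hm.injOn_fst).trans hc)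
  have hsnd : M.image Prod.snd = Finset.univ := Finset.eq_univ_of_card _
    ((Finset.card_image_of_injOn hm.injOn_snd).trans hc)
  have h1 : ∑ e ∈ M, p e.1 = ∑ v, p v := by
    rw [← hfst, Finset.sum_image hm.injOn_fst]
  have h2 : ∑ e ∈ M, p e.2 = ∑ v, p v := by
    rw [← hsnd, Finset.sum_image hm.injOn_snd]
  have hsum : ∑ e ∈ M, layeredCost o c e = ∑ e ∈ M, (layeredCost o c e + p e.1 - p e.2) := by
    rw [Finset.sum_sub_distrib, Finset.sum_add_distrib, h1, h2]
    ring
  -- The vertex `(L, o)` has neither a loop nor a next layer, so only the back edge can cover it as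
  -- a source.
  have hback : ((Fin.last L, o), (0, o)) ∈ M := by
    obtain ⟨e, he, hel⟩ := Finset.mem_image.1 (hfst ▸ Finset.mem_univ (Fin.last L, o))
    have h3 := hM he
    simp only [layeredEdges, Finset.mem_filter, Finset.mem_univ, true_and] at h3
    obtain ⟨u, v⟩ := e
    simp only at hel
    subst hel
    rcases h3 with h3 | h3 | h3
    · exact absurd rfl h3.2.2
    · have := v.1.2
      simp at h3
      omega
    · rw [← h3.2]
      exact he
  have hback_cost : layeredCost o c (((Fin.last L, o), (0, o)) :
      (Fin (L + 1) × W) × (Fin (L + 1) × W)) = 0 := by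
    simp [layeredCost]
  have hnonneg : ∀ e ∈ M.erase ((Fin.last L, o), (0, o)), 0 ≤ layeredCost o c e + p e.1 - p e.2 := by
    intro e he
    obtain ⟨hne, he⟩ := Finset.mem_erase.1 he
    have h3 := hM he
    simp only [layeredEdges, Finset.mem_filter, Finset.mem_univ, true_and] at h3
    obtain ⟨⟨t, x⟩, ⟨t', y⟩⟩ := e
    by_cases h4 : (t : ℕ) + 1 = t'
    · have h5 : layerDist o c (t + 1) y ≤ layerDist o c t x +
          c t (if (t : ℕ) = 0 then o else x) y :=
        Finset.inf'_le (fun x => layerDist o c t x + c t (if (t : ℕ) = 0 then o else x) y)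
          (Finset.mem_univ x)
      simp only [layeredCost, h4, if_true, p]
      rw [h4] at h5
      linarith
    · rcases h3 with h3 | h3 | h3
      · simp only [layeredCost, h4, if_false, p]
        obtain ⟨rfl, rfl⟩ := Prod.mk.inj h3.1
        simp
      · exact absurd h3 h4
      · exact absurd (Prod.ext h3.1 h3.2) hne
  obtain ⟨X, hX, hd⟩ := exists_path_eq_layerDist (o := o) c L o
  -- Resetting the start to `o` is harmless: the distances already charge edges out of layer `0` as
  -- if they left `o`.
  refine ⟨fun i => if i = 0 then o else X i, by simp, by simp [hL.ne', hX], ?_⟩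
  have hle := Finset.sum_nonneg hnonneg
  rw [← Finset.add_sum_erase M (fun e => layeredCost o c e + p e.1 - p e.2) hback,
    hback_cost] at hsum
  have h0 : p (0, o) = 0 := rfl
  have hl : p (Fin.last L, o) = layerDist o c L o := rfl
  simp only [h0, hl, hd] at hsum
  have : ∑ i ∈ Finset.range L, c i (if i = 0 then o else X i) (X (i + 1)) ≤
      ∑ e ∈ M, layeredCost o c e := by linarith
  simpa using this

end

/-! ### Assembly and choice of parameters. -/

/-- Instances with `2 ^ (k + 1) * (2 * (k * D) + 1)` vertices on each side and `D ^ k - 1` critical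
values. -/
theorem exists_instance_of_pow (D k : ℕ) (hDk : 2 ≤ D ^ k) :
    ∃ (G : MatchingInstance) (Q : ℝ) (α : ℕ → ℝ),
      Fintype.card G.V + Fintype.card G.U = 2 * (2 ^ (k + 1) * (2 * (k * D) + 1)) ∧
        0 < α 2 ∧ StrictMonoOn α (Set.Icc 2 (D ^ k)) ∧ α (D ^ k) < Q ∧
        (∀ e ∈ G.edges, 0 ≤ G.reward e ∧ 0 ≤ G.cost e) ∧
        (∀ S ⊆ G.edges, G.setReward S ∈ Set.Icc (0 : ℝ) 1) ∧
        (∀ x ∈ Set.Icc (α 2) Q, ∀ e ∈ G.edges, 0 ≤ G.weight x e) ∧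
        (∀ i ∈ Set.Icc 2 (D ^ k), G.IsCriticalValue (α i) ∧
          ∀ M, G.IsMaxWeightMatching (α i) M → G.IsPerfectMatching M) ∧
        ∃ M : ℕ → Finset (G.V × G.U),
          (∀ i ∈ Set.Icc 2 (D ^ k), G.IsMaxWeightMatching (α i) (M i) ∧
            M i ∈ G.bestResponse (α i)) ∧
          Set.InjOn M (Set.Icc 2 (D ^ k)) := by
  have hk : k ≠ 0 := by
    rintro rfl
    simp at hDk
  have hD : 0 < D := by
    refine Nat.pos_of_ne_zero ?_
    rintro rfl
    simp [hk] at hDk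
  obtain ⟨a, b, P, p, hb, hends, hp, hmin, hlt⟩ := exists_parametric_shortest_paths D k hD
  generalize k * D = R at *
  generalize hL : 2 ^ (k + 1) - 1 = L at *
  have hL1 : L + 1 = 2 ^ (k + 1) := by
    have : 0 < 2 ^ (k + 1) := by positivity
    omega
  have hL0 : 0 < L := by
    have : 2 ^ 1 ≤ 2 ^ (k + 1) := Nat.pow_le_pow_right (by norm_num) (by omega)
    omega
  let W := Finset.Icc (-(R : ℤ)) R
  let o : W := ⟨0, by simp [W]⟩
  have hWabs : ∀ x : W, |(x : ℤ)| ≤ R := fun x => abs_le.2 (Finset.mem_Icc.1 x.2)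
  have hcard : Fintype.card (Fin (L + 1) × W) = 2 ^ (k + 1) * (2 * R + 1) := by
    rw [Fintype.card_prod, Fintype.card_fin, Fintype.card_coe, Int.card_Icc, hL1]
    congr 1
    omega
  let X : ℕ → ℕ → W := fun r t =>
    if h : |P r t| ≤ R then ⟨P r t, Finset.mem_Icc.2 (abs_le.1 h)⟩ else o
  have hX : ∀ r < D ^ k, ∀ t ≤ L, (X r t : ℤ) = P r t := by
    intro r hr t ht
    simp only [X, hb r hr t ht, dif_pos]
  have hX0 : ∀ r < D ^ k, X r 0 = o := fun r hr =>
    Subtype.ext ((hX r hr 0 (Nat.zero_le _)).trans (hends r).1)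
  have hXL : ∀ r < D ^ k, X r L = o := fun r hr =>
    Subtype.ext ((hX r hr L le_rfl).trans (hends r).2)
  let c : ℝ → ℕ → W → W → ℝ := fun l t x y => a t x y + l * b t x y
  have hcost : ∀ l e, layeredCost (L := L) o (fun t x y => a t x y) e
      + l * layeredCost (L := L) o (fun t x y => b t x y) e = layeredCost o (c l) e := by
    intro l e
    simp only [layeredCost, c]
    split_ifs <;> ring
  have hpath : ∀ l, ∀ r < D ^ k, ∑ e ∈ pathMatching L (X r), layeredCost o (c l) e =
      ∑ t ∈ Finset.range L, (a t (P r t) (P r (t + 1)) + l * b t (P r t) (P r (t + 1))) := by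
    intro l r hr
    rw [sum_layeredCost_pathMatching (hX0 r hr)]
    refine Finset.sum_congr rfl fun t ht => ?_
    have := Finset.mem_range.1 ht
    simp only [c, hX r hr t this.le, hX r hr (t + 1) this]
  obtain ⟨G, Q, α, hV, hU, h⟩ := exists_perturbed_instance (layeredEdges L o)
    (layeredCost o fun t x y => a t x y) (layeredCost o fun t x y => b t x y) hDk hp
    (M := fun r => pathMatching L (X r)) (fun r hr => pathMatching_subset (hX0 r hr) (hXL r hr))
    (fun r _ => isBipartiteMatching_pathMatching _) (fun r _ => card_pathMatching _)
    (fun r hr M' hM' hm' hc' => by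
      simp only [hcost]
      obtain ⟨Y, hY0, hYL, hY⟩ := exists_path_le_sum_layeredCost hL0 (c (p r)) hM' hm' hc'
      refine le_trans ?_ hY
      rw [hpath _ r hr]
      exact hmin r hr (fun t => Y t) (fun t _ => hWabs _) (by rw [hY0]) (by rw [hYL]))
    (fun r hr => by
      simp only [hcost]
      rw [hpath _ r (by omega), hpath _ (r + 1) hr]
      exact hlt r (by omega) (r + 1) hr (by omega))
  exact ⟨G, Q, α, by rw [hV, hU, hcard]; ring, h⟩

theorem mainTheorem1 :
    ∃ (G : ℕ → MatchingInstance) (Q : ℕ → ℝ) (m : ℕ → ℕ) (α : ℕ → ℕ → ℝ),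
      ((fun n : ℕ => ((Fintype.card (G n).V + Fintype.card (G n).U : ℕ) : ℝ))
        =O[atTop] fun n : ℕ => (n : ℝ) ^ 4) ∧
      (∃ κ : ℝ, 0 < κ ∧
        ∀ᶠ n : ℕ in atTop, (2 : ℝ) ^ (κ * Real.log (n : ℝ) ^ 2) ≤ (m n : ℝ)) ∧
      ∀ n : ℕ,
        2 ≤ m n ∧ 0 < α n 2 ∧ StrictMonoOn (α n) (Set.Icc 2 (m n)) ∧ α n (m n) < Q n ∧
        (∀ e ∈ (G n).edges, 0 ≤ (G n).reward e ∧ 0 ≤ (G n).cost e) ∧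
        (∀ S ⊆ (G n).edges, (G n).setReward S ∈ Set.Icc (0 : ℝ) 1) ∧
        (∀ a ∈ Set.Icc (α n 2) (Q n), ∀ e ∈ (G n).edges, 0 ≤ (G n).weight a e) ∧
        (∀ i ∈ Set.Icc 2 (m n), (G n).IsCriticalValue (α n i) ∧
          ∀ M, (G n).IsMaxWeightMatching (α n i) M → (G n).IsPerfectMatching M) ∧
        ∃ M : ℕ → Finset ((G n).V × (G n).U),
          (∀ i ∈ Set.Icc 2 (m n), (G n).IsMaxWeightMatching (α n i) (M i) ∧
            M i ∈ (G n).bestResponse (α n i)) ∧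
          Set.InjOn M (Set.Icc 2 (m n)) := by
  -- For `n ≥ 1` this gives `n ≤ 2 ^ k n ≤ 2 * n`; the added `1` also keeps `k n` positive at `n =
  -- 0` and `n = 1`, as `hm` requires.
  let k : ℕ → ℕ := fun n => Nat.log 2 n + 1
  have hm : ∀ n, 2 ≤ (2 ^ k n) ^ k n := fun n => by
    rw [← pow_mul]
    calc 2 = 2 ^ 1 := by norm_num
      _ ≤ 2 ^ (k n * k n) := Nat.pow_le_pow_right (by norm_num) (by simp only [k]; nlinarith)
  choose G Q α hcard h using fun n => exists_instance_of_pow (2 ^ k n) (k n) (hm n)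
  refine ⟨G, Q, fun n => (2 ^ k n) ^ k n, α, ?_, ⟨1, one_pos, ?_⟩, fun n => ⟨hm n, h n⟩⟩
  · refine IsBigO.of_bound 100 ?_
    filter_upwards [eventually_ge_atTop 1] with n hn
    have h1 : 2 ^ k n ≤ 2 * n := by
      rw [show k n = Nat.log 2 n + 1 from rfl, pow_succ, mul_comm]
      exact Nat.mul_le_mul_left 2 (Nat.pow_log_le_self 2 (by omega))
    have h2 : k n ≤ 2 * n := (Nat.lt_two_pow_self.le).trans h1
    have h3 : Fintype.card (G n).V + Fintype.card (G n).U ≤ 100 * n ^ 4 := by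
      rw [hcard, pow_succ]
      calc 2 * (2 ^ k n * 2 * (2 * (k n * 2 ^ k n) + 1))
          ≤ 2 * (2 * n * 2 * (2 * (2 * n * (2 * n)) + 1)) := by gcongr
        _ ≤ 2 * (2 * n * 2 * (2 * (2 * n * (2 * n)) + n ^ 2)) := by
          gcongr
          exact Nat.one_le_pow _ _ hn
        _ = 72 * n ^ 3 * 1 := by ring
        _ ≤ 100 * n ^ 3 * n := by gcongr; norm_num
        _ = 100 * n ^ 4 := by ring
    rw [Real.norm_of_nonneg (Nat.cast_nonneg _), Real.norm_of_nonneg (by positivity)]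
    exact_mod_cast h3
  · filter_upwards [eventually_ge_atTop 1] with n hn
    have hn' : (1 : ℝ) ≤ n := by exact_mod_cast hn
    have h1 : Real.log n ≤ k n := by
      have h2 : (n : ℝ) ≤ 2 ^ k n := by
        exact_mod_cast (Nat.lt_pow_succ_log_self (by norm_num) n).le
      calc Real.log n ≤ Real.log (2 ^ k n) := Real.log_le_log (by linarith) h2
        _ = k n * Real.log 2 := Real.log_pow _ _
        _ ≤ k n * 1 := by
          gcongr
          linarith [Real.log_two_lt_d9]
        _ = k n := mul_one _
    have h0 := Real.log_nonneg hn'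
    calc (2 : ℝ) ^ (1 * Real.log n ^ 2) ≤ 2 ^ ((k n * k n : ℕ) : ℝ) := by
          refine Real.rpow_le_rpow_of_exponent_le (by norm_num) ?_
          push_cast
          nlinarith
      _ = (((2 ^ k n) ^ k n : ℕ) : ℝ) := by
          rw [Real.rpow_natCast, ← pow_mul]
          push_cast
          rfl
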